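/- Consider a binary-symmetric parallel-relay (BSPR) network with $K\ge 1$ relays between a source and a destination. In each network use the source sends a bit $U$, relay $i$ receives $V_i=U\oplus Z_i$ and sends a bit $X_i$, and the destination receives $Y_i=X_i\oplus E_i$ for $i=1,\dots,K$; all noise bits $Z_i,E_i$ are independent of each other and over network uses. The network is symmetrical: $\Pr\{Z_i=1\}=p_s$ and $\Pr\{E_i=1\}=p_d$ for all $i$, where $0\le p_s<\tfrac12$ and $0\le p_d<\tfrac12$ are fixed and do not depend on $K$. An $(M,n)$ code consists of an encoder that maps each of $M$ messages to $n$ bits $U[1],\dots,U[n]$, relay functions $X_i[t]=f_{i,t}(V_i[1],\dots,V_i[t-1])$ for $1\le t\le n$, and a decoder that maps the bits $(Y_i[t])_{i,t}$ received by the destination to a message. A rate $R\in\mathbb R$ is achievable if for every $\epsilon>0$ and all sufficiently large $n$ there is a $(\lceil 2^{nR}\rceil,n)$ code whose average error probability, for a uniformly distributed message, is at most $\epsilon$. The capacity $C_K$ is the supremum of all achievable rates. The rate $R$ is achieved by coded transmission with forwarding relays if the codes can moreover be chosen with $X_i[1]=0$ and $X_i[t]=V_i[t-1]$ for all $i$ and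 all $2\le t\le n$. Let $R_{\mathrm{coded,f}}(K)=I(U;\bar Y)$, in bits, where $U$ is uniform on $\{0,1\}$ and $\bar Y=(Y_1,\dots,Y_K)$ with $Y_i=U\oplus Z_i\oplus E_i$, the bits $U,Z_1,\dots,Z_K,E_1,\dots,E_K$ being independent. Theorem. For every $K$, coded transmission with forwarding relays achieves every rate $R<R_{\mathrm{coded,f}}(K)$. The capacity $C_K$ is finite for every $K$, and $R_{\mathrm{coded,f}}(K)$ converges to the capacity as $K\to\infty$: $C_K-R_{\mathrm{coded,f}}(K)\to 0$, with $R_{\mathrm{coded,f}}(K)\to 1$ and $C_K\to 1$. -/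

import Mathlib

open Filter Topology

/-- A binary-symmetric parallel-relay (BSPR) network with `K` relays: the cross-over probabilities
of the binary symmetric channels from the source to relay `i` (`ps i`) and from relay `i` to the
destination (`pd i`), all in `[0, 1/2]`. -/
structure BSPRNetwork (K : ℕ) where
  ps : Fin K → ℝ
  pd : Fin K → ℝ
  ps_nonneg : ∀ i, 0 ≤ ps i
  ps_le : ∀ i, ps i ≤ 1 / 2
  pd_nonneg : ∀ i, 0 ≤ pd i
  pd_le : ∀ i, pd i ≤ 1 / 2

/-- The symmetrical BSPR network: all source-to-relay channels have cross-over probability `ps < 1/2`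
and all relay-to-destination channels have cross-over probability `pd < 1/2`. -/
def BSPRNetwork.symmetrical (K : ℕ) (ps pd : ℝ) (hs₀ : 0 ≤ ps) (hs : ps < 1 / 2)
    (hd₀ : 0 ≤ pd) (hd : pd < 1 / 2) : BSPRNetwork K where
  ps := fun _ => ps
  pd := fun _ => pd
  ps_nonneg := fun _ => hs₀
  ps_le := fun _ => hs.le
  pd_nonneg := fun _ => hd₀
  pd_le := fun _ => hd.le

/-- The probability that a bit that equals `1` with probability `p` takes the value `b`. -/
def bitProb (p : ℝ) (b : ZMod 2) : ℝ := if b = 1 then p else 1 - p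

/-- Mutual information (in bits) of a pair of random variables with finitely many values and joint
probability mass function `P`; terms with `P a b = 0` contribute `0`. -/
noncomputable def mutualInfo {α β : Type*} [Fintype α] [Fintype β] (P : α → β → ℝ) : ℝ :=
  ∑ a, ∑ b, P a b * Real.logb 2 (P a b / ((∑ b', P a b') * (∑ a', P a' b)))

/-- A code with `M` messages and `n` network uses for a network with `K` relays. Times are numbered
`0, …, n - 1`; the symbol that a relay sends at time `t` is a function of the `t` symbols that this
relay received at the times before `t`. -/
structure RelayCode (K M n : ℕ) where
  enc : Fin M → Fin n → ZMod 2
  relay : Fin K → (t : Fin n) → (Fin (t : ℕ) → ZMod 2) → ZMod 2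
  dec : (Fin K → Fin n → ZMod 2) → Fin M

namespace RelayCode

variable {K M n : ℕ}

/-- All relays are forwarding relays: `X_i[t] = V_i[t-1]`, and the first symbol sent is `0`. -/
def IsForwarding (c : RelayCode K M n) : Prop :=
  ∀ (i : Fin K) (t : Fin n) (v : Fin (t : ℕ) → ZMod 2),
    c.relay i t v = if h : 0 < (t : ℕ) then v ⟨(t : ℕ) - 1, Nat.sub_lt h Nat.one_pos⟩ else 0

/-- `V_i[t] = U[t] ⊕ Z_i[t]` when message `w` is sent and the source-to-relay noise is `z`. -/
def relayReceived (c : RelayCode K M n) (w : Fin M) (z : Fin K → Fin n → ZMod 2)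
    (i : Fin K) (t : Fin n) : ZMod 2 :=
  c.enc w t + z i t

/-- `X_i[t]`, computed from `V_i[s]`, `s < t`. -/
def relaySent (c : RelayCode K M n) (w : Fin M) (z : Fin K → Fin n → ZMod 2)
    (i : Fin K) (t : Fin n) : ZMod 2 :=
  c.relay i t (fun s => c.relayReceived w z i ⟨(s : ℕ), s.isLt.trans t.isLt⟩)

/-- `Y_i[t] = X_i[t] ⊕ E_i[t]`. -/
def destReceived (c : RelayCode K M n) (w : Fin M) (z e : Fin K → Fin n → ZMod 2)
    (i : Fin K) (t : Fin n) : ZMod 2 :=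
  c.relaySent w z i t + e i t

/-- Average error probability under uniform messages; the noise bits `Z_i[t]`, `E_i[t]` are all
independent, with `Z_i[t] = 1` with probability `N.ps i` and `E_i[t] = 1` with probability
`N.pd i`. -/
noncomputable def errorProb (N : BSPRNetwork K) (c : RelayCode K M n) : ℝ :=
  (1 / (M : ℝ)) * ∑ w : Fin M, ∑ z : Fin K → Fin n → ZMod 2, ∑ e : Fin K → Fin n → ZMod 2,
    if c.dec (c.destReceived w z e) = w then 0
    else ∏ i, ∏ t, bitProb (N.ps i) (z i t) * bitProb (N.pd i) (e i t)

end RelayCode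

namespace BSPRNetwork

variable {K : ℕ}

/-- The rate `R` is achievable: for every `ε > 0` and all sufficiently large `n` there is a code
with `⌈2 ^ (n R)⌉` messages and `n` network uses whose average error probability is at most `ε`. -/
def Achievable (N : BSPRNetwork K) (R : ℝ) : Prop :=
  ∀ ε : ℝ, 0 < ε → ∀ᶠ n : ℕ in atTop,
    ∃ c : RelayCode K ⌈(2 : ℝ) ^ ((n : ℝ) * R)⌉₊ n, c.errorProb N ≤ ε

/-- The rate `R` is achieved by coded transmission at the source with forwarding relays. -/
def ForwardAchievable (N : BSPRNetwork K) (R : ℝ) : Prop :=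
  ∀ ε : ℝ, 0 < ε → ∀ᶠ n : ℕ in atTop,
    ∃ c : RelayCode K ⌈(2 : ℝ) ^ ((n : ℝ) * R)⌉₊ n, c.IsForwarding ∧ c.errorProb N ≤ ε

/-- The capacity: the supremum of all achievable rates. -/
noncomputable def capacity (N : BSPRNetwork K) : ℝ := sSup {R : ℝ | N.Achievable R}

/-- The transition probability `Pr{Ȳ = y | U = u}` of the effective channel with forwarding relays,
`Y_i = U ⊕ Z_i ⊕ E_i`. -/
noncomputable def forwardLaw (N : BSPRNetwork K) (u : ZMod 2) (y : Fin K → ZMod 2) : ℝ :=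
  ∑ z : Fin K → ZMod 2, ∑ e : Fin K → ZMod 2,
    if (fun i => u + z i + e i) = y then ∏ i, bitProb (N.ps i) (z i) * bitProb (N.pd i) (e i) else 0

/-- `R_coded,f = I(U; Ȳ)`, evaluated with `U` uniform on `{0, 1}`. -/
noncomputable def rateCodedForward (N : BSPRNetwork K) : ℝ :=
  mutualInfo (fun (u : ZMod 2) (y : Fin K → ZMod 2) => (1 / 2) * N.forwardLaw u y)

end BSPRNetwork

/-! With forwarding relays the network is, up to a delay of one use, a memoryless channel from a bit
to `K` bits, namely `K` independent looks at the input through binary symmetric channels with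
cross-over probability `p = ps (1 - pd) + (1 - ps) pd < 1/2`. Feinstein's lemma with a Chernoff
bound (`exists_block_code`, `exists_tilt_lt_one`) gives codes for this channel at every rate below
`I(U; Ȳ)`; the lost network use does not affect the rate.

The only converse needed is `C_K ≤ 1`: for fixed noise, whatever the relays do, the output depends
on the message only through one of `2 ^ n` codewords (`one_sub_le_errorProb`).

The gap `1 - I(U; Ȳ)` is at most `2 / log 2` times the Bhattacharyya sum of the channel. That sum
factors over the relays as `(2 √(p (1 - p))) ^ K` and tends to `0`. As `I(U; Ȳ) ≤ C_K ≤ 1`, both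
limits follow. -/

/-! ### Random-coding bounds for finite memoryless channels. -/

theorem sum_pi_prod {ι α : Type*} [Fintype ι] [DecidableEq ι] [Fintype α] (h : ι → α → ℝ) :
    ∑ z : ι → α, ∏ i, h i (z i) = ∏ i, ∑ a, h i a := by
  rw [Finset.prod_univ_sum, Fintype.piFinset_univ]

/-- Feinstein's lemma: if under every input `x` a decoding set `B x` is likely on average, while each
`B x` is unlikely under the output law, then codewords can be chosen greedily. -/
theorem exists_greedy_code {X Y : Type*} [Fintype X] [Fintype Y] [DecidableEq Y]
    (μ : X → ℝ) (W : X → Y → ℝ) (hμ : ∀ x, 0 ≤ μ x) (hμ1 : ∑ x, μ x = 1) (hW : ∀ x y, 0 ≤ W x y)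
    (B : X → Finset Y) (δ η : ℝ)
    (hδ : ∀ x, ∑ y ∈ B x, ∑ x', μ x' * W x' y ≤ δ)
    (hη : 1 - η ≤ ∑ x, μ x * ∑ y ∈ B x, W x y) (hδ0 : 0 ≤ δ) (M : ℕ) :
    ∀ k ≤ M, ∃ (x : ℕ → X) (f : Y → ℕ),
      (∀ j < k, 1 - η - M * δ ≤ ∑ y with f y = j, W (x j) y) ∧
      ∑ y with f y < k, ∑ x', μ x' * W x' y ≤ k * δ := by
  have hne : Nonempty X := by
    by_contra h
    rw [not_nonempty_iff] at h
    simp at hμ1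
  intro k
  induction k with
  | zero =>
    intro _
    exact ⟨fun _ => hne.some, fun _ => 0, by simp, by simp⟩
  | succ k ih =>
    intro hk
    obtain ⟨x, f, hx, hf⟩ := ih (by omega)
    -- Labels `≥ k` mark outputs not yet assigned. Averaged over `μ`, removing the assigned outputs
    -- costs at most `k δ ≤ M δ`, so some input is still good.
    have key : ∃ a, 1 - η - M * δ ≤ ∑ y ∈ B a with ¬ f y < k, W a y := by
      by_contra hcon
      have hcon : ∀ a, ∑ y ∈ B a with ¬ f y < k, W a y < 1 - η - M * δ := fun a =>
        not_le.mp fun h => hcon ⟨a, h⟩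
      have h1 : ∑ a, μ a * ∑ y ∈ B a with ¬ f y < k, W a y < 1 - η - M * δ := by
        have hle : ∀ a ∈ Finset.univ, μ a * ∑ y ∈ B a with ¬ f y < k, W a y
            ≤ μ a * (1 - η - M * δ) := fun a _ =>
          mul_le_mul_of_nonneg_left (hcon a).le (hμ a)
        have hex : ∃ a ∈ Finset.univ, μ a * ∑ y ∈ B a with ¬ f y < k, W a y
            < μ a * (1 - η - M * δ) := by
          have : ∃ a ∈ Finset.univ, 0 < μ a := by
            by_contra! h0
            have := Finset.sum_nonpos h0
            linarith
          obtain ⟨a, ha, hpos⟩ := this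
          exact ⟨a, ha, mul_lt_mul_of_pos_left (hcon a) hpos⟩
        have := Finset.sum_lt_sum hle hex
        rwa [← Finset.sum_mul, hμ1, one_mul] at this
      have h2 : ∑ a, μ a * ∑ y ∈ B a, W a y ≤
          ∑ a, μ a * ∑ y ∈ B a with ¬ f y < k, W a y
            + ∑ y with f y < k, ∑ x', μ x' * W x' y := by
        rw [Finset.sum_comm, ← Finset.sum_add_distrib]
        refine Finset.sum_le_sum fun a _ => ?_
        rw [← Finset.mul_sum, ← mul_add]
        refine mul_le_mul_of_nonneg_left ?_ (hμ a)
        rw [← Finset.sum_filter_add_sum_filter_not (B a) (fun y => f y < k), add_comm]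
        gcongr
        · exact fun _ _ _ => hW _ _
        · exact Finset.subset_univ _
      have h3 : (k : ℝ) * δ ≤ M * δ := by
        gcongr
        omega
      linarith
    obtain ⟨a, ha⟩ := key
    refine ⟨Function.update x k a,
      -- The label `k + 1` keeps the remaining outputs unassigned for the next round.
      fun y => if f y < k then f y else if y ∈ B a then k else k + 1, ?_, ?_⟩
    · intro j hj
      rcases Nat.lt_succ_iff_lt_or_eq.mp hj with hjk | rfl
      · rw [Function.update_of_ne hjk.ne]
        refine (hx j hjk).trans_eq (Finset.sum_congr ?_ fun _ _ => rfl)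
        ext y
        simp only [Finset.mem_filter, Finset.mem_univ, true_and]
        split_ifs <;> omega
      · rw [Function.update_self]
        refine ha.trans_eq (Finset.sum_congr ?_ fun _ _ => rfl)
        ext y
        simp only [Finset.mem_filter, Finset.mem_univ, true_and]
        split_ifs with h1 h2
        · simp [h1]; omega
        · simp [h1, h2]
        · simp [h2]
    · have hsub : (Finset.univ.filter fun y =>
          (if f y < k then f y else if y ∈ B a then k else k + 1) < k + 1) ⊆
          (Finset.univ.filter fun y => f y < k) ∪ B a := by
        intro y
        simp only [Finset.mem_filter, Finset.mem_univ, true_and, Finset.mem_union]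
        split_ifs with h1 h2 <;> simp [*]
      have hq : ∀ y, 0 ≤ ∑ x', μ x' * W x' y := fun y =>
        Finset.sum_nonneg fun x' _ => mul_nonneg (hμ _) (hW _ _)
      have h1 := Finset.sum_le_sum_of_subset_of_nonneg hsub (f := fun y => ∑ x', μ x' * W x' y)
        (fun y _ _ => hq y)
      have h2 := Finset.sum_union_inter (s₁ := Finset.univ.filter fun y => f y < k) (s₂ := B a)
        (f := fun y => ∑ x', μ x' * W x' y)
      have h3 : 0 ≤ ∑ y ∈ (Finset.univ.filter fun y => f y < k) ∩ B a, ∑ x', μ x' * W x' y :=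
        Finset.sum_nonneg fun y _ => hq y
      have h4 := hδ a
      push_cast
      linarith

/-- The tilted sum whose powers bound the probability of a low information density. -/
theorem exists_tilt_lt_one {A B : Type*} [Fintype A] [Fintype B] (P Q : A → B → ℝ) (γ : ℝ)
    (hP : ∀ a b, 0 ≤ P a b) (hP1 : ∑ a, ∑ b, P a b = 1) (hQ : ∀ a b, P a b ≠ 0 → 0 < Q a b)
    (hγ : γ < ∑ a, ∑ b, P a b * Real.logb 2 (P a b / Q a b)) :
    ∃ s : ℝ, 0 < s ∧ ∑ a, ∑ b, P a b * ((2 : ℝ) ^ γ * (Q a b / P a b)) ^ s < 1 := by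
  set g : ℝ → ℝ := fun s => ∑ a, ∑ b, P a b * ((2 : ℝ) ^ γ * (Q a b / P a b)) ^ s with hg
  have hlog2 : 0 < Real.log 2 := Real.log_pos one_lt_two
  -- Since `g 0 = 1` and the slope at `0` is `log 2` times `γ` minus the mutual information, which
  -- is negative, `g` drops below `1` just to the right of `0`.
  have hd : HasDerivAt g (∑ a, ∑ b, P a b * (Real.log 2 * (γ - Real.logb 2 (P a b / Q a b)))) 0 := by
    refine HasDerivAt.fun_sum fun a _ => HasDerivAt.fun_sum fun b _ => ?_
    by_cases h0 : P a b = 0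
    · simp only [h0, zero_mul]
      exact hasDerivAt_const _ _
    · have hp : 0 < P a b := lt_of_le_of_ne (hP a b) (Ne.symm h0)
      have hq := hQ a b h0
      refine HasDerivAt.const_mul _ ?_
      have hpos : 0 < (2 : ℝ) ^ γ * (Q a b / P a b) := by positivity
      have := Real.hasStrictDerivAt_const_rpow hpos 0
      refine this.hasDerivAt.congr_deriv ?_
      rw [Real.rpow_zero, one_mul, Real.log_mul (by positivity) (by positivity),
        Real.log_rpow two_pos, Real.logb, ← inv_div (P a b), Real.log_inv]
      field_simp
      ring
  have hneg : ∑ a, ∑ b, P a b * (Real.log 2 * (γ - Real.logb 2 (P a b / Q a b))) < 0 := by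
    have : ∑ a, ∑ b, P a b * (Real.log 2 * (γ - Real.logb 2 (P a b / Q a b))) =
        Real.log 2 * (γ * (∑ a, ∑ b, P a b) - ∑ a, ∑ b, P a b * Real.logb 2 (P a b / Q a b)) := by
      simp only [Finset.mul_sum, ← Finset.sum_sub_distrib]
      refine Finset.sum_congr rfl fun a _ => Finset.sum_congr rfl fun b _ => ?_
      ring
    rw [this, hP1]
    nlinarith
  have hg0 : g 0 = 1 := by simp [hg, hP1]
  have hs := hd.tendsto_slope_zero_right
  have := (hs.eventually (gt_mem_nhds hneg)).and self_mem_nhdsWithin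
  obtain ⟨s, h1, h2⟩ := this.exists
  have h2' : 0 < s := h2
  refine ⟨s, h2', ?_⟩
  change g s < 1
  rw [zero_add, hg0, smul_eq_mul] at h1
  have : s⁻¹ > 0 := inv_pos.mpr h2'
  by_contra! hc
  nlinarith [mul_nonneg this.le (sub_nonneg.mpr hc)]

/-- Block codes for a memoryless channel with finite alphabets whose error probability is controlled
by the tilted sum and the number of messages. -/
theorem exists_block_code {A B : Type*} [Fintype A] [Fintype B] [DecidableEq B]
    (μ : A → ℝ) (W : A → B → ℝ) (hμ : ∀ a, 0 ≤ μ a) (hμ1 : ∑ a, μ a = 1)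
    (hW : ∀ a b, 0 ≤ W a b) (hW1 : ∀ a, ∑ b, W a b = 1) (γ s : ℝ) (hs : 0 < s) (m M : ℕ) :
    ∃ (x : ℕ → Fin m → A) (f : (Fin m → B) → ℕ), ∀ j < M,
      1 - (∑ a, ∑ b, μ a * W a b *
          ((2 : ℝ) ^ γ * ((μ a * ∑ a', μ a' * W a' b) / (μ a * W a b))) ^ s) ^ m
        - M * (((2 : ℝ) ^ γ) ^ m)⁻¹ ≤ ∑ y with f y = j, ∏ t, W (x j t) (y t) := by
  classical
  set Q : B → ℝ := fun b => ∑ a', μ a' * W a' b with hQdef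
  have hQ : ∀ b, 0 ≤ Q b := fun b => Finset.sum_nonneg fun a _ => mul_nonneg (hμ a) (hW a b)
  have hT : 0 < ((2 : ℝ) ^ γ) ^ m := by positivity
  set T : ℝ := ((2 : ℝ) ^ γ) ^ m with hTdef
  have hQm : ∀ y : Fin m → B, ∑ x : Fin m → A, (∏ t, μ (x t)) * ∏ t, W (x t) (y t)
      = ∏ t, Q (y t) := by
    intro y
    simp_rw [← Finset.prod_mul_distrib]
    exact sum_pi_prod fun t a => μ a * W a (y t)
  have hone : ∀ x : Fin m → A, ∑ y : Fin m → B, ∏ t, W (x t) (y t) = 1 := by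
    intro x
    rw [sum_pi_prod fun t b => W (x t) b]
    simp [hW1]
  have hμm : ∑ x : Fin m → A, ∏ t, μ (x t) = 1 := by
    rw [sum_pi_prod fun _ a => μ a]
    simp [hμ1]
  have hWm : ∀ (x : Fin m → A) (y : Fin m → B), 0 ≤ ∏ t, W (x t) (y t) := fun x y =>
    Finset.prod_nonneg fun t _ => hW _ _
  -- Outputs whose information density with `x` exceeds `m γ`; a change of measure then gives them
  -- output probability at most `T⁻¹`.
  let D : (Fin m → A) → Finset (Fin m → B) := fun x =>
    Finset.univ.filter fun y => T * ∏ t, Q (y t) < ∏ t, W (x t) (y t)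
  have hδ : ∀ x, ∑ y ∈ D x, ∑ x' : Fin m → A, (∏ t, μ (x' t)) * ∏ t, W (x' t) (y t) ≤ T⁻¹ := by
    intro x
    calc _ ≤ ∑ y ∈ D x, T⁻¹ * ∏ t, W (x t) (y t) := by
            refine Finset.sum_le_sum fun y hy => ?_
            rw [hQm, ← div_eq_inv_mul, le_div_iff₀ hT, mul_comm]
            exact (Finset.mem_filter.mp hy).2.le
      _ ≤ ∑ y : Fin m → B, T⁻¹ * ∏ t, W (x t) (y t) :=
            Finset.sum_le_sum_of_subset_of_nonneg (Finset.subset_univ _) fun y _ _ =>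
              mul_nonneg (inv_nonneg.mpr hT.le) (hWm x y)
      _ = T⁻¹ := by rw [← Finset.mul_sum, hone, mul_one]
  set φ : A → B → ℝ := fun a b => μ a * W a b *
    ((2 : ℝ) ^ γ * ((μ a * Q b) / (μ a * W a b))) ^ s with hφ
  -- Chernoff bound: off `D x` the ratio `T ∏ Q / ∏ W` is at least `1`, hence so is its `s`-th
  -- power. The factor `μ` is kept in both parts of the fraction to match the joint laws in
  -- `exists_tilt_lt_one`.
  have htail : ∀ (x : Fin m → A) (y : Fin m → B), y ∉ D x →
      (∏ t, μ (x t)) * ∏ t, W (x t) (y t) ≤ ∏ t, φ (x t) (y t) := by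
    intro x y hy
    have hnn : ∀ t, 0 ≤ (2 : ℝ) ^ γ * ((μ (x t) * Q (y t)) / (μ (x t) * W (x t) (y t))) := by
      intro t
      have := hμ (x t); have := hQ (y t); have := hW (x t) (y t)
      positivity
    have hy' : ∏ t, W (x t) (y t) ≤ T * ∏ t, Q (y t) := by
      simpa [D] using hy
    rw [hφ]
    simp only []
    rw [Finset.prod_mul_distrib, ← Finset.prod_mul_distrib,
      Real.finsetProd_rpow _ _ (fun t _ => hnn t)]
    by_cases h0 : ∏ t, μ (x t) * W (x t) (y t) = 0
    · simp [h0]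
    have hpos : 0 < ∏ t, μ (x t) * W (x t) (y t) :=
      lt_of_le_of_ne (Finset.prod_nonneg fun t _ => mul_nonneg (hμ _) (hW _ _)) (Ne.symm h0)
    refine le_mul_of_one_le_right hpos.le (Real.one_le_rpow ?_ hs.le)
    rw [Finset.prod_mul_distrib, Finset.prod_div_distrib, Finset.prod_const, Finset.card_univ,
      Fintype.card_fin, ← hTdef, ← mul_div_assoc, le_div_iff₀ hpos, one_mul,
      Finset.prod_mul_distrib, Finset.prod_mul_distrib]
    have h1 : 0 ≤ ∏ t, μ (x t) := Finset.prod_nonneg fun t _ => hμ _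
    nlinarith [mul_le_mul_of_nonneg_left hy' h1]
  have hφ0 : ∀ a b, 0 ≤ φ a b := by
    intro a b
    have := hμ a; have := hQ b; have := hW a b
    simp only [hφ]
    positivity
  have hη : 1 - (∑ a, ∑ b, φ a b) ^ m ≤
      ∑ x : Fin m → A, (∏ t, μ (x t)) * ∑ y ∈ D x, ∏ t, W (x t) (y t) := by
    have h1 : ∑ x : Fin m → A, ∑ y : Fin m → B, ∏ t, φ (x t) (y t) = (∑ a, ∑ b, φ a b) ^ m := by
      have : ∀ x : Fin m → A, ∑ y : Fin m → B, ∏ t, φ (x t) (y t) = ∏ t, ∑ b, φ (x t) b :=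
        fun x => sum_pi_prod fun t b => φ (x t) b
      simp_rw [this]
      rw [sum_pi_prod fun (_ : Fin m) a => ∑ b, φ a b]
      simp
    rw [← h1, sub_le_iff_le_add, ← Finset.sum_add_distrib, ← hμm]
    refine Finset.sum_le_sum fun x _ => ?_
    calc ∏ t, μ (x t) = (∏ t, μ (x t)) * ∑ y : Fin m → B, ∏ t, W (x t) (y t) := by
            rw [hone, mul_one]
      _ = (∏ t, μ (x t)) * ∑ y ∈ D x, ∏ t, W (x t) (y t)
          + ∑ y ∈ (D x)ᶜ, (∏ t, μ (x t)) * ∏ t, W (x t) (y t) := by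
            rw [← Finset.sum_add_sum_compl (D x), mul_add, Finset.mul_sum (D x)ᶜ]
      _ ≤ (∏ t, μ (x t)) * ∑ y ∈ D x, ∏ t, W (x t) (y t)
          + ∑ y ∈ (D x)ᶜ, ∏ t, φ (x t) (y t) := by
            gcongr with y hy
            exact htail x y (Finset.mem_compl.mp hy)
      _ ≤ _ := by
            gcongr
            · exact fun y _ _ => Finset.prod_nonneg fun t _ => hφ0 _ _
            · exact Finset.subset_univ _
  obtain ⟨x, f, hx, -⟩ := exists_greedy_code (fun x : Fin m → A => ∏ t, μ (x t))
    (fun x (y : Fin m → B) => ∏ t, W (x t) (y t))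
    (fun x => Finset.prod_nonneg fun t _ => hμ _) hμm
    hWm D T⁻¹ _ hδ hη (inv_nonneg.mpr hT.le) M M le_rfl
  exact ⟨x, f, hx⟩

/-! ### The effective channel of forwarding relays. -/

theorem bitProb_nonneg {p : ℝ} (h₀ : 0 ≤ p) (h : p ≤ 1 / 2) (b : ZMod 2) : 0 ≤ bitProb p b := by
  unfold bitProb
  split_ifs <;> linarith

theorem sum_zmod_two (f : ZMod 2 → ℝ) : ∑ b, f b = f 0 + f 1 := Fin.sum_univ_two f

theorem sum_bitProb (p : ℝ) : ∑ b, bitProb p b = 1 := by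
  rw [sum_zmod_two]
  simp [bitProb]

/-- The transition probability from the source to the destination through one forwarding relay. -/
noncomputable def cascadeLaw (p q : ℝ) (u b : ZMod 2) : ℝ :=
  ∑ a, bitProb p a * ∑ c, if u + a + c = b then bitProb q c else 0

/-- The bit is flipped overall exactly when one of the two hops flips it, and `b + u` is the total
noise in characteristic 2. -/
theorem cascadeLaw_eq (p q : ℝ) (u b : ZMod 2) :
    cascadeLaw p q u b = bitProb (p * (1 - q) + (1 - p) * q) (b + u) := by
  have h01 : ∀ v : ZMod 2, v = 0 ∨ v = 1 := by decide
  simp only [cascadeLaw, sum_zmod_two]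
  rcases h01 u with rfl | rfl <;> rcases h01 b with rfl | rfl <;>
    simp [bitProb, show (1 : ZMod 2) + 1 = 0 from rfl] <;> ring

theorem cascadeLaw_nonneg {p q : ℝ} (hp₀ : 0 ≤ p) (hp : p ≤ 1 / 2) (hq₀ : 0 ≤ q) (hq : q ≤ 1 / 2)
    (u b : ZMod 2) : 0 ≤ cascadeLaw p q u b := by
  refine Finset.sum_nonneg fun a _ => mul_nonneg (bitProb_nonneg hp₀ hp a) ?_
  refine Finset.sum_nonneg fun c _ => ?_
  split_ifs
  exacts [bitProb_nonneg hq₀ hq c, le_rfl]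

theorem sum_cascadeLaw (p q : ℝ) (u : ZMod 2) : ∑ b, cascadeLaw p q u b = 1 := by
  simp_rw [cascadeLaw_eq]
  exact (Fintype.sum_equiv (Equiv.addRight u) _ _ fun _ => rfl).trans (sum_bitProb _)

namespace BSPRNetwork

variable {K : ℕ} (N : BSPRNetwork K)

theorem forwardLaw_eq_prod (u : ZMod 2) (y : Fin K → ZMod 2) :
    N.forwardLaw u y = ∏ i, cascadeLaw (N.ps i) (N.pd i) u (y i) := by
  unfold forwardLaw cascadeLaw
  rw [← sum_pi_prod fun i a => bitProb (N.ps i) a *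
    ∑ c, if u + a + c = y i then bitProb (N.pd i) c else 0]
  refine Finset.sum_congr rfl fun z _ => ?_
  rw [Finset.prod_mul_distrib,
    ← sum_pi_prod fun i c => if u + z i + c = y i then bitProb (N.pd i) c else 0, Finset.mul_sum]
  refine Finset.sum_congr rfl fun e _ => ?_
  rw [Finset.prod_ite_zero]
  simp only [funext_iff, Finset.mem_univ, true_imp_iff, Finset.prod_mul_distrib]
  split_ifs <;> simp

theorem forwardLaw_nonneg (u : ZMod 2) (y : Fin K → ZMod 2) : 0 ≤ N.forwardLaw u y := by
  rw [forwardLaw_eq_prod]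
  exact Finset.prod_nonneg fun i _ =>
    cascadeLaw_nonneg (N.ps_nonneg i) (N.ps_le i) (N.pd_nonneg i) (N.pd_le i) _ _

theorem sum_forwardLaw (u : ZMod 2) : ∑ y, N.forwardLaw u y = 1 := by
  simp_rw [forwardLaw_eq_prod]
  rw [sum_pi_prod fun i b => cascadeLaw (N.ps i) (N.pd i) u b]
  simp [sum_cascadeLaw]

end BSPRNetwork

/-! ### Error probability of relay codes: converse and reduction to the effective channel. -/

theorem sum_pi_pi_prod {ι κ α : Type*} [Fintype ι] [DecidableEq ι] [Fintype κ] [DecidableEq κ]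
    [Fintype α] (h : ι → κ → α → ℝ) :
    ∑ z : ι → κ → α, ∏ i, ∏ t, h i t (z i t) = ∏ i, ∏ t, ∑ a, h i t a := by
  rw [sum_pi_prod fun i (z : κ → α) => ∏ t, h i t (z t)]
  exact Finset.prod_congr rfl fun i _ => sum_pi_prod _

namespace RelayCode

variable {K M n m : ℕ}

/-- The joint probability of the noise sequences. -/
noncomputable def noiseProb (N : BSPRNetwork K) (z e : Fin K → Fin n → ZMod 2) : ℝ :=
  ∏ i, ∏ t, bitProb (N.ps i) (z i t) * bitProb (N.pd i) (e i t)

theorem noiseProb_nonneg (N : BSPRNetwork K) (z e : Fin K → Fin n → ZMod 2) :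
    0 ≤ noiseProb N z e :=
  Finset.prod_nonneg fun i _ => Finset.prod_nonneg fun _ _ =>
    mul_nonneg (bitProb_nonneg (N.ps_nonneg i) (N.ps_le i) _)
      (bitProb_nonneg (N.pd_nonneg i) (N.pd_le i) _)

theorem sum_noiseProb (N : BSPRNetwork K) :
    ∑ z : Fin K → Fin n → ZMod 2, ∑ e : Fin K → Fin n → ZMod 2, noiseProb N z e = 1 := by
  simp only [noiseProb, Finset.prod_mul_distrib, ← Finset.mul_sum, ← Finset.sum_mul]
  rw [sum_pi_pi_prod fun i (_ : Fin n) c => bitProb (N.pd i) c,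
    sum_pi_pi_prod fun i (_ : Fin n) c => bitProb (N.ps i) c]
  simp [sum_bitProb]

theorem errorProb_eq (N : BSPRNetwork K) (c : RelayCode K M n) (hM : 0 < M) :
    c.errorProb N = 1 - (1 / (M : ℝ)) * ∑ w : Fin M, ∑ z : Fin K → Fin n → ZMod 2,
      ∑ e : Fin K → Fin n → ZMod 2,
        if c.dec (c.destReceived w z e) = w then noiseProb N z e else 0 := by
  have hM' : (M : ℝ) ≠ 0 := by positivity
  rw [eq_sub_iff_add_eq, errorProb, ← mul_add, ← Finset.sum_add_distrib]
  have : ∀ w : Fin M, (∑ z : Fin K → Fin n → ZMod 2, ∑ e : Fin K → Fin n → ZMod 2,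
      (if c.dec (c.destReceived w z e) = w then 0
      else ∏ i, ∏ t, bitProb (N.ps i) (z i t) * bitProb (N.pd i) (e i t))) +
      (∑ z : Fin K → Fin n → ZMod 2, ∑ e : Fin K → Fin n → ZMod 2,
        if c.dec (c.destReceived w z e) = w then noiseProb N z e else 0) = 1 := by
    intro w
    rw [← sum_noiseProb (n := n) N]
    simp only [← Finset.sum_add_distrib]
    refine Finset.sum_congr rfl fun z _ => Finset.sum_congr rfl fun e _ => ?_
    split_ifs <;> simp [noiseProb]
  simp [this, hM']

/-- For fixed noise, messages with the same codeword produce the same output, so at most one message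
per codeword is decoded correctly. -/
theorem card_correct_le (c : RelayCode K M n) (z e : Fin K → Fin n → ZMod 2) :
    (Finset.univ.filter fun w => c.dec (c.destReceived w z e) = w).card ≤ 2 ^ n := by
  have hinj : Set.InjOn c.enc
      (Finset.univ.filter fun w => c.dec (c.destReceived w z e) = w : Finset (Fin M)) := by
    intro w hw w' hw' h
    simp only [Finset.coe_filter, Finset.mem_univ, true_and, Set.mem_ofPred_eq] at hw hw'
    have : c.destReceived w z e = c.destReceived w' z e := by
      funext i t
      simp [destReceived, relaySent, relayReceived, h]
    rw [← hw, ← hw', this]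
  refine (Finset.card_le_card_of_injOn c.enc (fun _ _ => Finset.mem_univ _) hinj).trans_eq ?_
  simp [ZMod.card]

/-- At most `2 ^ n` messages can be distinguished in `n` network uses. -/
theorem one_sub_le_errorProb (N : BSPRNetwork K) (c : RelayCode K M n) (hM : 0 < M) :
    1 - 2 ^ n / (M : ℝ) ≤ c.errorProb N := by
  rw [errorProb_eq N c hM, div_eq_mul_one_div, mul_comm (2 ^ n : ℝ)]
  gcongr
  rw [Finset.sum_comm]
  calc _ = ∑ z : Fin K → Fin n → ZMod 2, ∑ e : Fin K → Fin n → ZMod 2,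
        ((Finset.univ.filter fun w => c.dec (c.destReceived w z e) = w).card : ℝ)
          * noiseProb N z e := by
          refine Finset.sum_congr rfl fun z _ => ?_
          rw [Finset.sum_comm]
          refine Finset.sum_congr rfl fun e _ => ?_
          rw [← Finset.sum_filter, Finset.sum_const, nsmul_eq_mul]
    _ ≤ ∑ z : Fin K → Fin n → ZMod 2, ∑ e : Fin K → Fin n → ZMod 2,
        (2 : ℝ) ^ n * noiseProb N z e := by
          gcongr with z _ e _
          · exact noiseProb_nonneg N z e
          · exact_mod_cast card_correct_le c z e
    _ = 2 ^ n := by simp only [← Finset.mul_sum, sum_noiseProb, mul_one]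

/-- The code with forwarding relays given by codewords and a decoder for the effective channel. -/
noncomputable def ofForwarding (hM : 0 < M) (x : ℕ → Fin m → ZMod 2)
    (f : (Fin m → Fin K → ZMod 2) → ℕ) : RelayCode K M (m + 1) where
  enc w t := if h : (t : ℕ) < m then x w ⟨t, h⟩ else 0
  relay _ t v := if h : 0 < (t : ℕ) then v ⟨(t : ℕ) - 1, Nat.sub_lt h Nat.one_pos⟩ else 0
  dec y := if h : f (fun t i => y i t.succ) < M then ⟨f fun t i => y i t.succ, h⟩ else ⟨0, hM⟩

theorem ofForwarding_isForwarding (hM : 0 < M) (x : ℕ → Fin m → ZMod 2)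
    (f : (Fin m → Fin K → ZMod 2) → ℕ) : (ofForwarding hM x f).IsForwarding :=
  fun _ _ _ => rfl

theorem ofForwarding_destReceived_succ (hM : 0 < M) (x : ℕ → Fin m → ZMod 2)
    (f : (Fin m → Fin K → ZMod 2) → ℕ) (w : Fin M) (z e : Fin K → Fin (m + 1) → ZMod 2)
    (i : Fin K) (t : Fin m) :
    (ofForwarding hM x f).destReceived w z e i t.succ =
      x w t + z i t.castSucc + e i t.succ := by
  simp [destReceived, relaySent, relayReceived, ofForwarding]
  rfl

/-- The output at time `t + 1` carries source noise from time `t` and destination noise from time `t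
+ 1`. The last source noise and the first destination noise are free and sum to `1`; `Fin.snoc` and
`Fin.cons` put these two exceptional factors in place. -/
theorem sum_noiseProb_forward (N : BSPRNetwork K) (x : Fin m → ZMod 2)
    (y : Fin m → Fin K → ZMod 2) :
    (∑ z : Fin K → Fin (m + 1) → ZMod 2, ∑ e : Fin K → Fin (m + 1) → ZMod 2,
      if (fun t i => x t + z i t.castSucc + e i t.succ) = y then noiseProb N z e else 0) =
      ∏ t, N.forwardLaw (x t) (y t) := by
  have he : ∀ z : Fin K → Fin (m + 1) → ZMod 2,
      (∑ e : Fin K → Fin (m + 1) → ZMod 2,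
        if (fun t i => x t + z i t.castSucc + e i t.succ) = y then noiseProb N z e else 0) =
      ∏ i, ∏ t : Fin (m + 1), Fin.snoc (α := fun _ => ZMod 2 → ℝ)
        (fun t : Fin m => fun a => bitProb (N.ps i) a *
          ∑ c, if x t + a + c = y t i then bitProb (N.pd i) c else 0) (bitProb (N.ps i)) t (z i t) := by
    intro z
    have h1 := sum_pi_pi_prod (fun (i : Fin K) (t : Fin (m + 1)) (c : ZMod 2) =>
      Fin.cons (α := fun _ => ZMod 2 → ℝ) (bitProb (N.pd i))
        (fun t : Fin m => fun c =>
          if x t + z i t.castSucc + c = y t i then bitProb (N.pd i) c else 0) t c)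
    simp only [Fin.prod_univ_succ, Fin.cons_zero, Fin.cons_succ, sum_bitProb, one_mul] at h1
    simp only [Fin.prod_univ_castSucc, Fin.snoc_castSucc, Fin.snoc_last]
    simp only [Finset.prod_mul_distrib]
    rw [← h1, mul_right_comm, Finset.mul_sum]
    refine Finset.sum_congr rfl fun e _ => ?_
    by_cases h : ∀ i t, x t + z i t.castSucc + e i t.succ = y t i
    · rw [if_pos (funext fun t => funext fun i => h i t)]
      simp only [h, if_true, noiseProb, Finset.prod_mul_distrib,
        Fin.prod_univ_castSucc (n := m) (fun t => bitProb (N.ps _) _),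
        Fin.prod_univ_succ (n := m) (fun t => bitProb (N.pd _) _)]
    · rw [if_neg fun h' => h fun i t => congrFun (congrFun h' t) i]
      simp only [not_forall] at h
      obtain ⟨i, t, hit⟩ := h
      have h0 : ∏ i, bitProb (N.pd i) (e i 0) * ∏ t, (if x t + z i t.castSucc + e i t.succ = y t i
          then bitProb (N.pd i) (e i t.succ) else 0) = 0 :=
        Finset.prod_eq_zero (Finset.mem_univ i) (mul_eq_zero_of_right _
          (Finset.prod_eq_zero (Finset.mem_univ t) (if_neg hit)))
      rw [h0, mul_zero]
  simp_rw [he]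
  rw [sum_pi_pi_prod (fun (i : Fin K) (t : Fin (m + 1)) (a : ZMod 2) =>
    Fin.snoc (α := fun _ => ZMod 2 → ℝ) (fun t : Fin m => fun a => bitProb (N.ps i) a *
      ∑ c, if x t + a + c = y t i then bitProb (N.pd i) c else 0) (bitProb (N.ps i)) t a)]
  simp only [Fin.prod_univ_castSucc, Fin.snoc_castSucc, Fin.snoc_last, sum_bitProb, mul_one]
  rw [Finset.prod_comm]
  simp only [BSPRNetwork.forwardLaw_eq_prod, cascadeLaw]

theorem ofForwarding_errorProb_le (N : BSPRNetwork K) (hM : 0 < M) (x : ℕ → Fin m → ZMod 2)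
    (f : (Fin m → Fin K → ZMod 2) → ℕ) (ε : ℝ)
    (h : ∀ j < M, 1 - ε ≤ ∑ y with f y = j, ∏ t, N.forwardLaw (x j t) (y t)) :
    (ofForwarding hM x f).errorProb N ≤ ε := by
  rw [errorProb_eq N _ hM]
  have key : ∀ w : Fin M, 1 - ε ≤ ∑ z : Fin K → Fin (m + 1) → ZMod 2,
      ∑ e : Fin K → Fin (m + 1) → ZMod 2,
        if (ofForwarding hM x f).dec ((ofForwarding hM x f).destReceived w z e) = w
          then noiseProb N z e else 0 := by
    intro w
    refine (h w w.2).trans ?_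
    simp_rw [← sum_noiseProb_forward]
    rw [Finset.sum_comm]
    refine Finset.sum_le_sum fun z _ => ?_
    rw [Finset.sum_comm]
    refine Finset.sum_le_sum fun e _ => ?_
    rw [Finset.sum_ite_eq]
    -- Only this direction is available: labels `≥ M` are decoded as message `0`, which can only add
    -- correct decisions.
    have hdec : f (fun t i => x w t + z i t.castSucc + e i t.succ) = w →
        (ofForwarding hM x f).dec ((ofForwarding hM x f).destReceived w z e) = w := by
      intro hf
      have : (fun t i => (ofForwarding hM x f).destReceived w z e i t.succ) =
          fun t i => x w t + z i t.castSucc + e i t.succ := by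
        funext t i
        exact ofForwarding_destReceived_succ hM x f w z e i t
      change (if h : f (fun t i => (ofForwarding hM x f).destReceived w z e i t.succ) < M
        then (⟨f fun t i => (ofForwarding hM x f).destReceived w z e i t.succ, h⟩ : Fin M)
        else ⟨0, hM⟩) = w
      simp only [this, hf, w.2, dite_true]
    simp only [Finset.mem_filter, Finset.mem_univ, true_and]
    split_ifs with h1 h2
    · exact le_rfl
    · exact absurd (hdec h1) h2
    · exact noiseProb_nonneg N z e
    · exact le_rfl
  have hsum := Finset.sum_le_sum fun w (_ : w ∈ Finset.univ) => key w
  rw [Finset.sum_const, Finset.card_univ, Fintype.card_fin, nsmul_eq_mul] at hsum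
  have hM' : (0 : ℝ) < M := by positivity
  have := mul_le_mul_of_nonneg_left hsum (one_div_pos.mpr hM').le
  rw [← mul_assoc, one_div_mul_cancel hM'.ne', one_mul] at this
  linarith

end RelayCode

/-! ### Bhattacharyya bound on the mutual information, capacity and the limit. -/

theorem log_one_add_le_two_mul_sqrt {x : ℝ} (hx : 0 ≤ x) : Real.log (1 + x) ≤ 2 * √x := by
  have hs := Real.sqrt_nonneg x
  have h1 : 1 + x ≤ (1 + √x) ^ 2 := by nlinarith [Real.sq_sqrt hx]
  calc Real.log (1 + x) ≤ Real.log ((1 + √x) ^ 2) := Real.log_le_log (by positivity) h1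
    _ = 2 * Real.log (1 + √x) := by rw [Real.log_pow]; norm_num
    _ ≤ 2 * √x := by
      have := Real.log_le_sub_one_of_pos (show 0 < 1 + √x by positivity)
      linarith

/-- Here `a` and `b` are the likelihoods of one output under the two inputs. The right side is `(a /
2) (1 - log₂ (1 + b / a))`, and bounding the logarithm by a square root produces `a √(b / a) = √(a
b)`. -/
theorem le_mul_logb_posterior {a b : ℝ} (ha : 0 ≤ a) (hb : 0 ≤ b) :
    1 / 2 * a - 1 / Real.log 2 * √(a * b) ≤
      1 / 2 * a * Real.logb 2 (1 / 2 * a / (1 / 2 * (1 / 2 * (a + b)))) := by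
  have hlog2 : 0 < Real.log 2 := Real.log_pos one_lt_two
  rcases ha.eq_or_lt with rfl | ha
  · simp
  have h1 : 1 / 2 * a / (1 / 2 * (1 / 2 * (a + b))) = 2 * (1 + b / a)⁻¹ := by
    field_simp
  have h2 := log_one_add_le_two_mul_sqrt (div_nonneg hb ha.le)
  have h3 : √(a * b) = a * √(b / a) := by
    rw [show a * b = a ^ 2 * (b / a) by field_simp, Real.sqrt_mul (sq_nonneg a),
      Real.sqrt_sq ha.le]
  rw [h1, Real.logb_mul two_ne_zero (by positivity), Real.logb_self_eq_one one_lt_two,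
    Real.logb_inv, h3, Real.logb]
  have h4 : Real.log (1 + b / a) / Real.log 2 ≤ 2 * √(b / a) / Real.log 2 := by gcongr
  have h5 := mul_le_mul_of_nonneg_left h4 (show 0 ≤ 1 / 2 * a by positivity)
  have h6 : 1 / 2 * a * (2 * √(b / a) / Real.log 2) = 1 / Real.log 2 * (a * √(b / a)) := by
    field_simp
  linarith

theorem bhattacharyya_lt_one {p : ℝ} (hp : p < 1 / 2) :
    2 * √((1 - p) * p) < 1 := by
  have : √((1 - p) * p) < 1 / 2 := by
    rw [Real.sqrt_lt' (by norm_num)]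
    nlinarith [sq_pos_of_pos (sub_pos.mpr hp)]
  linarith

namespace BSPRNetwork

variable {K : ℕ} (N : BSPRNetwork K)

/-- The mutual information of the effective channel is bounded through its Bhattacharyya
coefficient. -/
theorem one_sub_le_rateCodedForward :
    1 - 2 / Real.log 2 * ∑ y, √(N.forwardLaw 0 y * N.forwardLaw 1 y) ≤ N.rateCodedForward := by
  unfold rateCodedForward mutualInfo
  simp only [← Finset.mul_sum, sum_forwardLaw, sum_zmod_two, mul_one]
  have h0 : ∑ y, (1 / 2 * N.forwardLaw 0 y - 1 / Real.log 2 *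
      √(N.forwardLaw 0 y * N.forwardLaw 1 y)) ≤ _ := Finset.sum_le_sum fun y _ =>
    le_mul_logb_posterior (N.forwardLaw_nonneg 0 y) (N.forwardLaw_nonneg 1 y)
  have h1 : ∑ y, (1 / 2 * N.forwardLaw 1 y - 1 / Real.log 2 *
      √(N.forwardLaw 1 y * N.forwardLaw 0 y)) ≤ _ := Finset.sum_le_sum fun y _ =>
    le_mul_logb_posterior (N.forwardLaw_nonneg 1 y) (N.forwardLaw_nonneg 0 y)
  rw [Finset.sum_sub_distrib, ← Finset.mul_sum, ← Finset.mul_sum, sum_forwardLaw] at h0 h1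
  simp only [mul_comm (N.forwardLaw 1 _) (N.forwardLaw 0 _),
    add_comm (N.forwardLaw 1 _) (N.forwardLaw 0 _)] at h1
  refine le_trans (le_of_eq ?_) (add_le_add h0 h1)
  ring

theorem achievable_of_forwardAchievable {R : ℝ} (h : N.ForwardAchievable R) : N.Achievable R :=
  fun ε hε => (h ε hε).mono fun _ ⟨c, _, hc⟩ => ⟨c, hc⟩

theorem le_one_of_achievable {R : ℝ} (h : N.Achievable R) : R ≤ 1 := by
  by_contra! hR
  -- Then there are at least `4 * 2 ^ n` messages, so the error is at least `3 / 4`, against the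
  -- demanded `1 / 2`.
  have hev : ∀ᶠ n : ℕ in atTop, 2 ≤ (n : ℝ) * (R - 1) :=
    (tendsto_natCast_atTop_atTop.atTop_mul_const (sub_pos.mpr hR)).eventually_ge_atTop 2
  obtain ⟨n, ⟨c, hc⟩, hn⟩ := ((h (1 / 2) (by norm_num)).and hev).exists
  have hM : 0 < ⌈(2 : ℝ) ^ ((n : ℝ) * R)⌉₊ := Nat.ceil_pos.mpr (by positivity)
  have h1 := c.one_sub_le_errorProb N hM
  have h2 : (2 : ℝ) ^ n * 4 ≤ (⌈(2 : ℝ) ^ ((n : ℝ) * R)⌉₊ : ℝ) := by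
    refine le_trans ?_ (Nat.le_ceil _)
    calc (2 : ℝ) ^ n * 4 = (2 : ℝ) ^ ((n : ℝ) + 2) := by
          rw [Real.rpow_add two_pos, Real.rpow_natCast]
          norm_num
      _ ≤ _ := Real.rpow_le_rpow_of_exponent_le one_le_two (by linarith)
  have h3 : (2 : ℝ) ^ n / (⌈(2 : ℝ) ^ ((n : ℝ) * R)⌉₊ : ℝ) ≤ 1 / 4 := by
    rw [div_le_iff₀ (by exact_mod_cast hM)]
    linarith
  linarith

/-- The channel coding theorem for the effective channel of forwarding relays. -/
theorem forwardAchievable_of_lt {R : ℝ} (hR : R < N.rateCodedForward) : N.ForwardAchievable R := by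
  intro ε hε
  -- A negative rate asks for a single message, which is never decoded wrongly. Otherwise `γ > 0`,
  -- as the rounding term below needs.
  rcases lt_or_ge R 0 with hneg | hR0
  · filter_upwards [eventually_gt_atTop 0] with n hn
    have hM : ⌈(2 : ℝ) ^ ((n : ℝ) * R)⌉₊ = 1 := by
      rw [Nat.ceil_eq_iff one_ne_zero]
      refine ⟨by simpa using Real.rpow_pos_of_pos two_pos _, ?_⟩
      have hn' : (0 : ℝ) < n := by exact_mod_cast hn
      simpa using Real.rpow_le_one_of_one_le_of_nonpos one_le_two
        (mul_nonpos_of_nonneg_of_nonpos hn'.le hneg.le)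
    rw [hM]
    obtain ⟨m, rfl⟩ := Nat.exists_eq_succ_of_ne_zero hn.ne'
    refine ⟨RelayCode.ofForwarding one_pos (fun _ _ => 0) (fun _ => 0),
      RelayCode.ofForwarding_isForwarding _ _ _, ?_⟩
    have : (RelayCode.ofForwarding (K := K) (m := m) one_pos (fun _ _ => 0)
        (fun _ => 0)).errorProb N = 0 := by
      simp [RelayCode.errorProb, eq_iff_true_of_subsingleton]
    exact this.trans_le hε.le
  obtain ⟨γ, hRγ, hγ⟩ := exists_between hR
  set μ : ZMod 2 → ℝ := fun _ => 1 / 2 with hμ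
  have hμ1 : ∑ a, μ a = 1 := by
    rw [sum_zmod_two]
    norm_num [hμ]
  set P : ZMod 2 → (Fin K → ZMod 2) → ℝ := fun a b => μ a * N.forwardLaw a b with hP
  set Q : ZMod 2 → (Fin K → ZMod 2) → ℝ :=
    fun a b => μ a * ∑ a', μ a' * N.forwardLaw a' b with hQ
  have hP0 : ∀ a b, 0 ≤ P a b := fun a b => mul_nonneg (by norm_num [hμ]) (N.forwardLaw_nonneg a b)
  obtain ⟨s, hs, hlt⟩ := exists_tilt_lt_one P Q γ hP0
    (by simp_rw [hP, ← Finset.mul_sum, sum_forwardLaw, mul_one, hμ1])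
    (by
      intro a b hab
      have hpos : 0 < P a b := lt_of_le_of_ne (hP0 a b) (Ne.symm hab)
      refine mul_pos (by norm_num [hμ]) (hpos.trans_le ?_)
      exact Finset.single_le_sum (f := fun a' => P a' b) (fun a' _ => hP0 a' b)
        (Finset.mem_univ a))
    (by
      refine hγ.trans_eq ?_
      simp [rateCodedForward, mutualInfo, hP, hQ, hμ, ← Finset.mul_sum, sum_forwardLaw])
  set g := ∑ a, ∑ b, P a b * ((2 : ℝ) ^ γ * (Q a b / P a b)) ^ s with hg
  have hg0 : 0 ≤ g := by
    refine Finset.sum_nonneg fun a _ => Finset.sum_nonneg fun b _ => mul_nonneg (hP0 a b) ?_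
    refine Real.rpow_nonneg (mul_nonneg (by positivity) (div_nonneg ?_ (hP0 a b))) _
    exact mul_nonneg (by norm_num [hμ]) (Finset.sum_nonneg fun a' _ => hP0 a' b)
  have hγ0 : 0 < γ := hR0.trans_lt hRγ
  -- The Chernoff tail, plus `2 ^ (-γ m)` times the bound `2 ^ ((m + 1) R) + 1` on the number of
  -- messages: the factor `2 ^ R` pays for the lost use, the last term for the ceiling.
  have hlim : Tendsto (fun m : ℕ => g ^ m + ((2 : ℝ) ^ R * ((2 : ℝ) ^ (R - γ)) ^ m
      + ((2 : ℝ) ^ (-γ)) ^ m)) atTop (𝓝 (0 + ((2 : ℝ) ^ R * 0 + 0))) := by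
    refine (tendsto_pow_atTop_nhds_zero_of_lt_one hg0 hlt).add
      (Tendsto.add (Tendsto.const_mul _ ?_) ?_)
    · exact tendsto_pow_atTop_nhds_zero_of_lt_one (by positivity)
        (Real.rpow_lt_one_of_one_lt_of_neg one_lt_two (by linarith))
    · exact tendsto_pow_atTop_nhds_zero_of_lt_one (by positivity)
        (Real.rpow_lt_one_of_one_lt_of_neg one_lt_two (by linarith))
  have hev := hlim.eventually (ge_mem_nhds (show 0 + ((2 : ℝ) ^ R * 0 + 0) < ε by simpa using hε))
  rw [← map_add_atTop_eq_nat 1, eventually_map]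
  filter_upwards [hev] with m hm
  have hM : 0 < ⌈(2 : ℝ) ^ (((m + 1 : ℕ) : ℝ) * R)⌉₊ := Nat.ceil_pos.mpr (by positivity)
  have hMle : (⌈(2 : ℝ) ^ (((m + 1 : ℕ) : ℝ) * R)⌉₊ : ℝ) * (((2 : ℝ) ^ γ) ^ m)⁻¹ ≤
      (2 : ℝ) ^ R * ((2 : ℝ) ^ (R - γ)) ^ m + ((2 : ℝ) ^ (-γ)) ^ m := by
    have h1 := (Nat.ceil_lt_add_one
      (show 0 ≤ (2 : ℝ) ^ (((m + 1 : ℕ) : ℝ) * R) by positivity)).le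
    have h2 := mul_le_mul_of_nonneg_right h1
      (show 0 ≤ (((2 : ℝ) ^ γ) ^ m)⁻¹ by positivity)
    refine h2.trans_eq ?_
    have h3 : (2 : ℝ) ^ (((m + 1 : ℕ) : ℝ) * R) = (2 : ℝ) ^ R * ((2 : ℝ) ^ R) ^ m := by
      rw [← Real.rpow_natCast ((2 : ℝ) ^ R), ← Real.rpow_mul two_pos.le, ← Real.rpow_add two_pos]
      congr 1
      push_cast
      ring
    rw [h3, Real.rpow_sub two_pos, Real.rpow_neg two_pos.le, div_pow, inv_pow]
    ring
  obtain ⟨x, f, hx⟩ := exists_block_code μ N.forwardLaw (fun _ => by norm_num [hμ]) hμ1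
    N.forwardLaw_nonneg N.sum_forwardLaw γ s hs m ⌈(2 : ℝ) ^ (((m + 1 : ℕ) : ℝ) * R)⌉₊
  refine ⟨RelayCode.ofForwarding hM x f, RelayCode.ofForwarding_isForwarding hM x f,
    RelayCode.ofForwarding_errorProb_le N hM x f ε fun j hj => le_trans ?_ (hx j hj)⟩
  change _ ≤ 1 - g ^ m - _
  linarith

/-- This excludes the default value of the real `sSup` on empty or unbounded sets. -/
theorem isLUB_capacity : IsLUB {R : ℝ | N.Achievable R} N.capacity := by
  refine isLUB_csSup ⟨N.rateCodedForward - 1, ?_⟩ ⟨1, fun R hR => N.le_one_of_achievable hR⟩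
  exact N.achievable_of_forwardAchievable (N.forwardAchievable_of_lt (by linarith))

theorem capacity_le_one : N.capacity ≤ 1 :=
  (isLUB_le_iff N.isLUB_capacity).mpr fun _ hR => N.le_one_of_achievable hR

theorem rateCodedForward_le_capacity : N.rateCodedForward ≤ N.capacity :=
  le_of_forall_lt_imp_le_of_dense fun _ hR => N.isLUB_capacity.1
    (N.achievable_of_forwardAchievable (N.forwardAchievable_of_lt hR))

theorem tendsto_rateCodedForward_symmetrical {ps pd : ℝ} (hs₀ : 0 ≤ ps) (hs : ps < 1 / 2)
    (hd₀ : 0 ≤ pd) (hd : pd < 1 / 2) :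
    Tendsto (fun K : ℕ => (symmetrical K ps pd hs₀ hs hd₀ hd).rateCodedForward) atTop (𝓝 1) := by
  set p := ps * (1 - pd) + (1 - ps) * pd with hp
  -- From `1 - 2 p = (1 - 2 ps) (1 - 2 pd)`.
  have hp2 : p < 1 / 2 := by nlinarith [mul_pos (sub_pos.mpr hs) (sub_pos.mpr hd)]
  -- Bhattacharyya coefficients multiply over independent looks at the same input.
  have hB : ∀ K : ℕ, ∑ y, √((symmetrical K ps pd hs₀ hs hd₀ hd).forwardLaw 0 y *
      (symmetrical K ps pd hs₀ hs hd₀ hd).forwardLaw 1 y) = (2 * √((1 - p) * p)) ^ K := by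
    intro K
    have hy : ∀ y : Fin K → ZMod 2, √((symmetrical K ps pd hs₀ hs hd₀ hd).forwardLaw 0 y *
        (symmetrical K ps pd hs₀ hs hd₀ hd).forwardLaw 1 y) =
        ∏ i, √(cascadeLaw ps pd 0 (y i) * cascadeLaw ps pd 1 (y i)) := by
      intro y
      rw [forwardLaw_eq_prod, forwardLaw_eq_prod, ← Finset.prod_mul_distrib, Real.sqrt_prod]
      · rfl
      · exact fun i _ => mul_nonneg (cascadeLaw_nonneg hs₀ hs.le hd₀ hd.le _ _)
          (cascadeLaw_nonneg hs₀ hs.le hd₀ hd.le _ _)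
    simp_rw [hy]
    rw [sum_pi_prod fun (_ : Fin K) b => √(cascadeLaw ps pd 0 b * cascadeLaw ps pd 1 b)]
    simp only [sum_zmod_two, cascadeLaw_eq, ← hp]
    simp [bitProb, show (1 : ZMod 2) + 1 = 0 from rfl, mul_comm p, two_mul]
  have hlim : Tendsto (fun K : ℕ => 1 - 2 / Real.log 2 * (2 * √((1 - p) * p)) ^ K) atTop
      (𝓝 (1 - 2 / Real.log 2 * 0)) :=
    ((tendsto_pow_atTop_nhds_zero_of_lt_one (by positivity)
      (bhattacharyya_lt_one hp2)).const_mul _).const_sub _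
  rw [mul_zero, sub_zero] at hlim
  refine tendsto_of_tendsto_of_tendsto_of_le_of_le hlim tendsto_const_nhds (fun K => ?_) fun K =>
    (rateCodedForward_le_capacity _).trans (capacity_le_one _)
  simp only [← hB]
  exact one_sub_le_rateCodedForward _

end BSPRNetwork

theorem mainTheorem2 (ps pd : ℝ) (hs₀ : 0 ≤ ps) (hs : ps < 1 / 2) (hd₀ : 0 ≤ pd)
    (hd : pd < 1 / 2) :
    -- every rate below `R_coded,f` is achieved with forwarding relays
    (∀ (K : ℕ) (R : ℝ),
      R < (BSPRNetwork.symmetrical K ps pd hs₀ hs hd₀ hd).rateCodedForward →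
        (BSPRNetwork.symmetrical K ps pd hs₀ hs hd₀ hd).ForwardAchievable R) ∧
    -- the capacity is a genuine (finite) supremum
    (∀ K : ℕ, IsLUB {R : ℝ | (BSPRNetwork.symmetrical K ps pd hs₀ hs hd₀ hd).Achievable R}
      (BSPRNetwork.symmetrical K ps pd hs₀ hs hd₀ hd).capacity) ∧
    -- `R_coded,f` converges to the capacity, and both converge to `1`
    Tendsto (fun K : ℕ => (BSPRNetwork.symmetrical K ps pd hs₀ hs hd₀ hd).capacity -
      (BSPRNetwork.symmetrical K ps pd hs₀ hs hd₀ hd).rateCodedForward) atTop (𝓝 0) ∧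
    Tendsto (fun K : ℕ => (BSPRNetwork.symmetrical K ps pd hs₀ hs hd₀ hd).rateCodedForward)
      atTop (𝓝 1) ∧
    Tendsto (fun K : ℕ => (BSPRNetwork.symmetrical K ps pd hs₀ hs hd₀ hd).capacity)
      atTop (𝓝 1) := by
  have hr := BSPRNetwork.tendsto_rateCodedForward_symmetrical hs₀ hs hd₀ hd
  have hc : Tendsto (fun K : ℕ => (BSPRNetwork.symmetrical K ps pd hs₀ hs hd₀ hd).capacity)
      atTop (𝓝 1) :=
    tendsto_of_tendsto_of_tendsto_of_le_of_le hr tendsto_const_nhds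
      (fun K => BSPRNetwork.rateCodedForward_le_capacity _)
      fun K => BSPRNetwork.capacity_le_one _
  refine ⟨fun K R hR => BSPRNetwork.forwardAchievable_of_lt _ hR,
    fun K => BSPRNetwork.isLUB_capacity _, ?_, hr, hc⟩
  simpa using hc.sub hr
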